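/- Let $X$ be $[0,1]$ or $\mathbb R$, and let $\mathrm{Diff}^1_+(X)$ be the group of orientation-preserving $C^1$-diffeomorphisms of $X$ (with one-sided derivatives at the ends of $[0,1]$). For $f\in \mathrm{Diff}^1_+(X)$, the support $\mathrm{Supp}(f)$ is the closure of $\{x : f(x)\neq x\}$. A fundamental domain of $f$ is a segment with end points $x$ and $f(x)$, where $f(x)\ne x$. We say that $f$ is without hyperbolic fixed points if $Df(x)=1$ whenever $f(x)=x$, and that $f$ is simple if $\{x: f(x)\ne x\}$ is non-empty and connected. A family $(f_i)_{i\in\mathcal I}$ in $\mathrm{Diff}^1_+(X)$ with given fundamental domains $I_i$ of $f_i$ is called nested if for all $i\neq j$: either $\mathrm{Supp}(f_i)\subset I_j$, or $\mathrm{Supp}(f_j)\subset I_i$, or the interiors of $\mathrm{Supp}(f_i)$ and $\mathrm{Supp}(f_j)$ are disjoint. A group $G\subset \mathrm{Diff}^1_+(X)$ is $C^1$-close to the identity if there is a sequence $h_n\in \mathrm{Diff}^1_+(X)$, $n\in\mathbb N$, such that for every $g\in G$, $h_n g h_n^{-1}\to \mathrm{id}$ in the (uniform) $C^1$-topology as $n\to\infty$.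 It is isotopic by conjugacy to the identity if there is a $C^1$-continuous path $h_t\in \mathrm{Diff}^1_+(X)$, $t\in[0,1)$ (that is, $h_t(x)$ and $Dh_t(x)$ are continuous in $(t,x)$), such that for every $g\in G$, $h_t g h_t^{-1}\to\mathrm{id}$ in the (uniform) $C^1$-topology as $t\to 1$. A group $G\subset \mathrm{Diff}^1_+([0,1])$ is elementary if it is generated by a fundamental system, i.e. by a nested family of pairwise distinct simple diffeomorphisms $f_i\in \mathrm{Diff}^1_+([0,1])$ (for some choice of fundamental domains $I_i$) with $Df_i(0)=Df_i(1)=1$; equivalently, the $f_i$ are restrictions to $[0,1]$ of $C^1$-diffeomorphisms of $\mathbb R$ supported in $[0,1]$. Then: 1. Every elementary group $G\subset \mathrm{Diff}^1_+([0,1])$ is $C^1$-close to the identity. 2. Let $G\subset \mathrm{Diff}^1_+([0,1])$ be elementary, and let $H\subset \mathrm{Diff}^1_+([0,1])$ be a group such that $H=\varphi G\varphi^{-1}$ for some homeomorphism $\varphi$ of $[0,1]$ and $Dk(0)=Dk(1)=1$ for every $k\in H$. Then $H$ is $C^1$-close to the identity. 3. Let $(f_i)_{i\in\mathcal I}$ be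 a family in $\mathrm{Diff}^1_+([0,1])$, nested for given fundamental domains $I_i$ of $f_i$, such that every $f_i$ is without hyperbolic fixed points (the $f_i$ need not be simple). Then the group generated by the $f_i$ is $C^1$-close to the identity, and isotopic by conjugacy to the identity, in $\mathrm{Diff}^1_+([0,1])$. 4. Let $(f_i)_{i\in\mathcal I}$ be a family of diffeomorphisms in $\mathrm{Diff}^1_+(\mathbb R)$ with compact support, nested for given fundamental domains $I_i$ of $f_i$, such that every $f_i$ is without hyperbolic fixed points. Then the group generated by the $f_i$ is $C^1$-close to the identity, and isotopic by conjugacy to the identity, in $\mathrm{Diff}^1_+(\mathbb R)$. -/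

import Mathlib

open Set Filter Topology

/-- The real function that equals the bijection `e` of `s` on `s` and the identity off `s`. -/
noncomputable def extendById {s : Set ℝ} (e : Equiv.Perm s) : ℝ → ℝ :=
  Function.extend Subtype.val (fun x : s => (e x : ℝ)) id

theorem extendById_coe {s : Set ℝ} (e : Equiv.Perm s) (x : s) :
    extendById e x = e x :=
  Subtype.val_injective.extend_apply _ _ _

theorem extendById_contDiffOn_mul {s : Set ℝ} {e f : Equiv.Perm s}
    (he : ContDiffOn ℝ 1 (extendById e) s) (hf : ContDiffOn ℝ 1 (extendById f) s) :
    ContDiffOn ℝ 1 (extendById (e * f)) s := by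
  have hm : MapsTo (extendById f) s s := by
    intro x hx
    rw [extendById_coe f ⟨x, hx⟩]
    exact (f ⟨x, hx⟩).2
  refine (he.comp hf hm).congr ?_
  intro x hx
  rw [extendById_coe (e * f) ⟨x, hx⟩, Function.comp_apply, extendById_coe f ⟨x, hx⟩,
    extendById_coe, Equiv.Perm.mul_apply]

/-- The orientation-preserving `C¹` diffeomorphisms of `s`, as a group of bijections of `s`;
it is used for `s = [0,1]` (with one-sided derivatives at the ends) and for `s = ℝ`. -/
def diffOneSubgroup (s : Set ℝ) : Subgroup (Equiv.Perm s) where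
  carrier := {e | StrictMono e ∧ ContDiffOn ℝ 1 (extendById e) s ∧
    ContDiffOn ℝ 1 (extendById e⁻¹) s}
  one_mem' := by
    have h : ContDiffOn ℝ 1 (extendById (1 : Equiv.Perm s)) s := by
      refine contDiffOn_id.congr ?_
      intro x hx
      rw [extendById_coe 1 ⟨x, hx⟩]
      rfl
    exact ⟨fun _ _ hxy => hxy, h, by rw [inv_one]; exact h⟩
  mul_mem' := by
    rintro e f ⟨he, he1, he2⟩ ⟨hf, hf1, hf2⟩
    refine ⟨fun _ _ hxy => he (hf hxy), extendById_contDiffOn_mul he1 hf1, ?_⟩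
    rw [mul_inv_rev]
    exact extendById_contDiffOn_mul hf2 he2
  inv_mem' := by
    rintro e ⟨he, he1, he2⟩
    refine ⟨?_, he2, by rw [inv_inv]; exact he1⟩
    intro x y hxy
    rw [← he.lt_iff_lt]
    simpa using hxy

/-- The group `Diff¹₊(s)`. -/
abbrev DiffOne (s : Set ℝ) : Type := ↥(diffOneSubgroup s)

namespace DiffOne

variable {s : Set ℝ}

/-- The derivative of `g` at a point of `s`. -/
noncomputable def D (g : DiffOne s) (x : s) : ℝ :=
  derivWithin (extendById g.1) s x

/-- The support: the closure (in `s`) of the set of points that are not fixed. -/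
def supp (g : DiffOne s) : Set s := closure {x | g.1 x ≠ x}

/-- Every fixed point of `g` has derivative `1`. -/
def WithoutHyperbolicFixedPoint (g : DiffOne s) : Prop :=
  ∀ x : s, g.1 x = x → g.D x = 1

/-- A fundamental domain: the segment between a point that is not fixed and its image. -/
def IsFundamentalDomain (g : DiffOne s) (I : Set s) : Prop :=
  ∃ x : s, (x < g.1 x ∧ I = Icc x (g.1 x)) ∨ (g.1 x < x ∧ I = Icc (g.1 x) x)

/-- The complement of the fixed point set has exactly one connected component. -/
def IsSimple (g : DiffOne s) : Prop := IsConnected {x : s | g.1 x ≠ x}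

/-- Convergence in the (uniform) `C¹` topology along a filter. -/
def TendstoC1 {α : Type*} (F : α → DiffOne s) (l : Filter α) (g : DiffOne s) : Prop :=
  TendstoUniformly (fun a (x : s) => ((F a).1 x : ℝ)) (fun x : s => (g.1 x : ℝ)) l ∧
  TendstoUniformly (fun a (x : s) => (F a).D x) (fun x : s => g.D x) l

/-- Each `f i` has the fundamental domain `I i`, and the supports of two different members of the
family have disjoint interiors, or one lies in the fundamental domain of the other. -/
def NestedFundamentalDomains {ι : Type*} (f : ι → DiffOne s) (I : ι → Set s) : Prop :=
  (∀ i, (f i).IsFundamentalDomain (I i)) ∧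
  ∀ i j, i ≠ j →
    (f i).supp ⊆ I j ∨ (f j).supp ⊆ I i ∨ interior (f i).supp ∩ interior (f j).supp = ∅

/-- There are `h n` with `h n * g * (h n)⁻¹ → id` in the `C¹` topology, for every `g ∈ G`. -/
def IsC1CloseToId (G : Subgroup (DiffOne s)) : Prop :=
  ∃ h : ℕ → DiffOne s, ∀ g ∈ G, TendstoC1 (fun n => h n * g * (h n)⁻¹) atTop 1

/-- There is a `C¹`-continuous path `h t`, `t ∈ [0,1)`, such that `h t * g * (h t)⁻¹ → id` in the
`C¹` topology as `t → 1`, for every `g ∈ G`. -/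
def IsIsotopicByConjugacyToId (G : Subgroup (DiffOne s)) : Prop :=
  ∃ h : ℝ → DiffOne s,
    ContinuousOn (fun p : ℝ × s => ((h p.1).1 p.2 : ℝ)) (Ico 0 1 ×ˢ univ) ∧
    ContinuousOn (fun p : ℝ × s => (h p.1).D p.2) (Ico 0 1 ×ˢ univ) ∧
    ∀ g ∈ G, TendstoC1 (fun t => h t * g * (h t)⁻¹) (𝓝[<] 1) 1

/-- The derivative of a diffeomorphism of `[0,1]` is `1` at both ends; equivalently, its extension
by the identity is a `C¹` diffeomorphism of `ℝ`. -/
def IsTangentToIdAtEnds (g : DiffOne (Icc (0 : ℝ) 1)) : Prop :=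
  g.D ⟨0, by simp⟩ = 1 ∧ g.D ⟨1, by simp⟩ = 1

/-- `G` is generated by a fundamental system supported in `[0,1]`: a set `S` of simple
diffeomorphisms, which extend by the identity to `C¹` diffeomorphisms of `ℝ`, with fundamental
domains `I f` such that the supports are pairwise nested or have disjoint interiors. -/
def IsElementary (G : Subgroup (DiffOne (Icc (0 : ℝ) 1))) : Prop :=
  ∃ (S : Set (DiffOne (Icc (0 : ℝ) 1))) (I : S → Set (Icc (0 : ℝ) 1)),
    (∀ f ∈ S, f.IsSimple ∧ f.IsTangentToIdAtEnds) ∧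
    NestedFundamentalDomains (fun f : S => (f : DiffOne (Icc (0 : ℝ) 1))) I ∧
    G = Subgroup.closure S

/-- `H = φ G φ⁻¹` for some homeomorphism `φ`. -/
def TopConjugate (G H : Subgroup (DiffOne s)) : Prop :=
  ∃ φ : s ≃ₜ s,
    (∀ g ∈ G, ∃ k ∈ H, ∀ x, k.1 (φ x) = φ (g.1 x)) ∧
    (∀ k ∈ H, ∃ g ∈ G, ∀ x, k.1 (φ x) = φ (g.1 x))

end DiffOne

/-! If `h` has derivative `exp (φ + c)` with `c` constant, then at `h x` the logarithm of the
derivative of `h f h⁻¹` is `φ (f x) - φ x + log Df x`. So the generators are conjugated towards the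
identity once `-log Df` is, up to a small uniform error, a coboundary `φ ∘ f - φ`, with one `φ`
serving finitely many generators at once.

For a single `f`, the function `u = -log Df` vanishes at the fixed points because none is
hyperbolic. Orbits are monotone and bounded, so they spend little time where `u` is not small; the
averages of `u` along orbits tend uniformly to `0`, and averaged Birkhoff sums solve the equation
approximately (`exists_approx_transfer`).

For a finite nested family, take the generator with the longest fundamental domain. Every other
support lies in that domain or in the fixed point set of this generator. Solve for it first, solve
the corrected equations of the others by induction, then spread that solution along the orbits of
the first generator with slowly decaying weights. The result is almost invariant under the first
generator and unchanged on the other supports (`exists_almost_invariant`,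
`exists_approx_transfer_finset`).

A nested family is countable, so finite subfamilies exhaust it; affine interpolation of the
resulting functions gives a path. Topological conjugacy carries a fundamental system to a
fundamental system, which reduces the conjugate groups to the elementary ones. -/

namespace DiffOne

/-! ### Approximate cohomological equations for one diffeomorphism -/

section Cohomology

variable {s : Set ℝ}

theorem continuous_coe (g : DiffOne s) : Continuous g.1 := by
  refine Continuous.subtype_mk (f := fun x => (g.1 x : ℝ)) ?_ (fun x => (g.1 x).2)
  refine (g.2.2.1.continuousOn.domRestrict).congr fun x => ?_
  exact extendById_coe g.1 x

theorem inv_apply_eq_self_iff (g : DiffOne s) (x : s) : (g⁻¹).1 x = x ↔ g.1 x = x := by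
  change g.1⁻¹ x = x ↔ _
  rw [Equiv.Perm.inv_eq_iff_eq, eq_comm]

theorem zpow_add_apply (g : DiffOne s) (j k : ℤ) (x : s) :
    (g ^ (j + k)).1 x = (g ^ j).1 ((g ^ k).1 x) := by
  rw [zpow_add]; rfl

theorem zpow_apply_eq_self (g : DiffOne s) {x : s} (h : g.1 x = x) (k : ℤ) :
    (g ^ k).1 x = x := by
  have : (g ^ k).1 = g.1 ^ k := rfl
  rw [this]
  exact Equiv.Perm.zpow_apply_eq_self_of_apply_eq_self h k

theorem isOpen_ne (g : DiffOne s) : IsOpen {x | g.1 x ≠ x} :=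
  isOpen_ne_fun g.continuous_coe continuous_id

theorem mem_supp {g : DiffOne s} {x : s} (h : g.1 x ≠ x) : x ∈ g.supp := subset_closure h

theorem mem_interior_supp {g : DiffOne s} {x : s} (h : g.1 x ≠ x) : x ∈ interior g.supp :=
  interior_maximal subset_closure g.isOpen_ne h

/-- The set where `|u| ≥ ε` is compact and contains no fixed point, so the displacement of `g` has a
positive lower bound on it. -/
theorem exists_abs_le_add_mul (g : DiffOne s) (hK : IsCompact g.supp) {u : s → ℝ}
    (hc : Continuous u) (hu : ∀ x, g.1 x = x → u x = 0) {ε : ℝ} (hε : 0 < ε) :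
    ∃ C, 0 ≤ C ∧ ∀ x, |u x| ≤ ε + C * |(g.1 x : ℝ) - x| := by
  have hcl : IsClosed {x | ε ≤ |u x|} := isClosed_le continuous_const hc.abs
  have hsub : {x | ε ≤ |u x|} ⊆ g.supp := by
    intro x hx
    refine mem_supp fun h => ?_
    have hx' : ε ≤ |u x| := hx
    rw [hu x h, abs_zero] at hx'
    exact absurd hx' (not_le.2 hε)
  have hcomp : IsCompact {x | ε ≤ |u x|} := hK.of_isClosed_subset hcl hsub
  have hdc : Continuous fun x : s => |(g.1 x : ℝ) - x| :=
    ((continuous_subtype_val.comp g.continuous_coe).sub continuous_subtype_val).abs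
  have hne : ∀ x ∈ {x | ε ≤ |u x|}, |(g.1 x : ℝ) - x| ≠ 0 := by
    intro x hx h
    have h1 : g.1 x = x := Subtype.ext (by linarith [abs_eq_zero.1 h])
    have hx' : ε ≤ |u x| := hx
    rw [hu x h1, abs_zero] at hx'
    exact absurd hx' (not_le.2 hε)
  obtain ⟨C, hC⟩ := hcomp.exists_bound_of_continuousOn (f := fun x => |u x| / |(g.1 x : ℝ) - x|)
    (hc.abs.continuousOn.div hdc.continuousOn hne)
  refine ⟨max C 0, le_max_right _ _, fun x => ?_⟩
  by_cases hx : ε ≤ |u x|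
  · have h1 := (le_abs_self _).trans (hC x hx)
    have h2 : 0 < |(g.1 x : ℝ) - x| := lt_of_le_of_ne (abs_nonneg _) (hne x hx).symm
    rw [div_le_iff₀ h2] at h1
    have h3 := mul_le_mul_of_nonneg_right (le_max_left C 0) h2.le
    linarith
  · have := mul_nonneg (le_max_right C 0) (abs_nonneg ((g.1 x : ℝ) - x))
    linarith

/-- Orbits of an increasing map are monotone, so the displacements all have the same sign and
telescope. -/
theorem sum_abs_iterate_sub (g : DiffOne s) (x : s) (n : ℕ) :
    ∑ k ∈ Finset.range n, |(g.1^[k + 1] x : ℝ) - (g.1^[k] x : s)| = |(g.1^[n] x : ℝ) - x| := by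
  rcases le_total x (g.1 x) with h | h
  · have hm : Monotone fun k => (g.1^[k] x : ℝ) := g.2.1.monotone.monotone_iterate_of_le_map h
    have h0 : (x : ℝ) ≤ g.1^[n] x := hm (Nat.zero_le n)
    rw [abs_of_nonneg (sub_nonneg.2 h0),
      show (g.1^[n] x : ℝ) - x = g.1^[n] x - g.1^[0] x from rfl,
      ← Finset.sum_range_sub (fun k => (g.1^[k] x : ℝ))]
    exact Finset.sum_congr rfl fun k _ => abs_of_nonneg (sub_nonneg.2 (hm k.le_succ))
  · have hm : Antitone fun k => (g.1^[k] x : ℝ) := g.2.1.monotone.antitone_iterate_of_map_le h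
    have h0 : (g.1^[n] x : ℝ) ≤ x := hm (Nat.zero_le n)
    rw [abs_of_nonpos (sub_nonpos.2 h0),
      show (g.1^[n] x : ℝ) - x = g.1^[n] x - g.1^[0] x from rfl,
      ← Finset.sum_range_sub (fun k => (g.1^[k] x : ℝ)),
      ← Finset.sum_neg_distrib]
    exact Finset.sum_congr rfl fun k _ => abs_of_nonpos (sub_nonpos.2 (hm k.le_succ))

theorem exists_abs_iterate_sub_le (g : DiffOne s) (hK : IsCompact g.supp) :
    ∃ R, ∀ x n, |(g.1^[n] x : ℝ) - x| ≤ R := by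
  obtain ⟨R, hR⟩ := hK.exists_bound_of_continuousOn
    (f := fun x : s => (x : ℝ)) continuous_subtype_val.continuousOn
  refine ⟨max (R + R) 0, fun x n => ?_⟩
  by_cases hx : g.1 x = x
  · rw [Function.iterate_fixed hx]; simp
  · have h1 : ∀ n, g.1 (g.1^[n] x) ≠ g.1^[n] x := by
      intro n
      induction n with
      | zero => exact hx
      | succ n ih => rw [Function.iterate_succ_apply']; exact g.1.injective.ne ih
    have h2 := hR _ (mem_supp (h1 n))
    have h3 := hR _ (mem_supp hx)
    rw [Real.norm_eq_abs] at h2 h3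
    exact (abs_sub _ _).trans ((add_le_add h2 h3).trans (le_max_left _ _))

/-- A function vanishing at the fixed points of `g` is almost a coboundary. -/
theorem exists_approx_transfer (g : DiffOne s) (hK : IsCompact g.supp) {u : s → ℝ}
    (hc : Continuous u) (hu : ∀ x, g.1 x = x → u x = 0) {ε : ℝ} (hε : 0 < ε) :
    ∃ φ : s → ℝ, Continuous φ ∧ (∀ x, g.1 x = x → φ x = 0) ∧
      ∀ x, |φ (g.1 x) - φ x - u x| ≤ ε := by
  obtain ⟨C, hC, hCu⟩ := g.exists_abs_le_add_mul hK hc hu (half_pos hε)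
  obtain ⟨R, hR⟩ := g.exists_abs_iterate_sub_le hK
  obtain ⟨n, hn⟩ := exists_nat_gt (C * R / (ε / 2))
  obtain ⟨N, rfl, hN⟩ : ∃ N, N = n + 1 ∧ C * R ≤ ε / 2 * (N : ℝ) := by
    refine ⟨n + 1, rfl, ?_⟩
    rw [div_lt_iff₀ (half_pos hε)] at hn
    push_cast
    nlinarith
  set N := n + 1
  have hN0 : (0 : ℝ) < N := by positivity
  -- With `S_j` the Birkhoff sums, `S_j (g x) - S_j x = u (g^j x) - u x`. Averaging over `j = 1, …,
  -- N` leaves as error the mean of `u` along the orbit, which is at most `ε / 2 + C R / N`.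
  refine ⟨fun x => -(1 / (N : ℝ)) * ∑ j ∈ Finset.range N, birkhoffSum g.1 u (j + 1) x, ?_, ?_, ?_⟩
  · refine continuous_const.mul (continuous_finsetSum _ fun j _ => ?_)
    exact continuous_finsetSum _ fun k _ => hc.comp (g.continuous_coe.iterate k)
  · intro x hx
    have : ∀ j, birkhoffSum g.1 u j x = 0 := fun j =>
      Finset.sum_eq_zero fun k _ => by rw [Function.iterate_fixed hx, hu x hx]
    simp [this]
  · intro x
    have h1 : ∑ j ∈ Finset.range N, birkhoffSum g.1 u (j + 1) (g.1 x)
        - ∑ j ∈ Finset.range N, birkhoffSum g.1 u (j + 1) x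
        = ∑ j ∈ Finset.range N, u (g.1^[j + 1] x) - N * u x := by
      rw [← Finset.sum_sub_distrib]
      simp_rw [birkhoffSum_apply_sub_birkhoffSum]
      rw [Finset.sum_sub_distrib]
      simp
    have h2 : -(1 / (N : ℝ)) * ∑ j ∈ Finset.range N, birkhoffSum g.1 u (j + 1) (g.1 x)
        - -(1 / (N : ℝ)) * ∑ j ∈ Finset.range N, birkhoffSum g.1 u (j + 1) x - u x
        = -((∑ j ∈ Finset.range N, u (g.1^[j + 1] x)) / N) := by
      have : ∑ j ∈ Finset.range N, birkhoffSum g.1 u (j + 1) (g.1 x) =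
        ∑ j ∈ Finset.range N, birkhoffSum g.1 u (j + 1) x +
        (∑ j ∈ Finset.range N, u (g.1^[j + 1] x) - N * u x) := by linarith
      rw [this]
      field_simp
      ring
    change |-(1 / (N : ℝ)) * ∑ j ∈ Finset.range N, birkhoffSum g.1 u (j + 1) (g.1 x)
        - -(1 / (N : ℝ)) * ∑ j ∈ Finset.range N, birkhoffSum g.1 u (j + 1) x - u x| ≤ ε
    rw [h2, abs_neg, abs_div, abs_of_pos hN0, div_le_iff₀ hN0]
    calc |∑ j ∈ Finset.range N, u (g.1^[j + 1] x)|
        ≤ ∑ j ∈ Finset.range N, |u (g.1^[j + 1] x)| := Finset.abs_sum_le_sum_abs _ _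
      _ ≤ ∑ j ∈ Finset.range N, (ε / 2 + C * |(g.1^[j + 1] (g.1 x) : ℝ) -
            (g.1^[j] (g.1 x) : s)|) := by
          refine Finset.sum_le_sum fun j _ => (hCu _).trans_eq ?_
          rw [← Function.iterate_succ_apply' g.1 (j + 1), ← Function.iterate_succ_apply g.1 (j + 1),
            ← Function.iterate_succ_apply g.1 j]
      _ = N * (ε / 2) + C * |(g.1^[N] (g.1 x) : ℝ) - g.1 x| := by
          rw [Finset.sum_add_distrib, ← Finset.mul_sum, sum_abs_iterate_sub]
          simp
      _ ≤ N * (ε / 2) + C * R := by gcongr; exact hR _ _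
      _ ≤ ε * N := by linarith

theorem le_zpow_apply {g : DiffOne s} {a b : s} (hab : a < b) (hg : g.1 a = b) {k : ℤ}
    (hk : 0 < k) : b ≤ (g ^ k).1 a := by
  have h1 : ∀ n : ℕ, a ≤ (g ^ (n : ℤ)).1 a := by
    intro n
    induction n with
    | zero => simp
    | succ n ih =>
      rw [Nat.cast_succ, add_comm, zpow_add_apply, zpow_one]
      exact hab.le.trans (hg ▸ g.2.1.monotone ih)
  obtain ⟨n, hn⟩ := Int.eq_ofNat_of_zero_le (Int.le_sub_one_of_lt hk)
  obtain rfl : k = 1 + (n : ℤ) := by lia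
  rw [zpow_add_apply, zpow_one]
  exact hg ▸ g.2.1.monotone (h1 n)

theorem zpow_apply_le {g : DiffOne s} {a b : s} (hab : a < b) (hg : g.1 a = b) {k : ℤ}
    (hk : k ≤ 0) : (g ^ k).1 a ≤ a := by
  rcases hk.eq_or_lt with rfl | hk
  · simp
  · rw [← (g ^ (-k)).2.1.le_iff_le, ← zpow_add_apply]
    simpa using hab.le.trans (le_zpow_apply hab hg (neg_pos.2 hk))

theorem zpow_apply_notMem_Ioo {g : DiffOne s} {a b : s} (hab : a < b) (hg : g.1 a = b) (k : ℤ) :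
    (g ^ k).1 a ∉ Ioo a b := by
  rcases le_or_gt k 0 with hk | hk
  · exact fun h => absurd h.1 (not_lt.2 (zpow_apply_le hab hg hk))
  · exact fun h => absurd h.2 (not_lt.2 (le_zpow_apply hab hg hk))

/-- The translates of the open fundamental domain under the powers of `g` are pairwise disjoint, so
an orbit visits it at most once. -/
theorem eq_of_zpow_apply_mem_Ioo {g : DiffOne s} {a b : s} (hab : a < b) (hg : g.1 a = b)
    {j k : ℤ} {x : s} (hj : (g ^ j).1 x ∈ Ioo a b) (hk : (g ^ k).1 x ∈ Ioo a b) : j = k := by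
  have key : ∀ {j k : ℤ}, (g ^ j).1 x ∈ Ioo a b → (g ^ k).1 x ∈ Ioo a b → ¬ j < k := by
    intro j k hj hk hjk
    have h1 := (g ^ (k - j)).2.1 hj.1
    rw [← zpow_add_apply, sub_add_cancel] at h1
    exact absurd hk.2 (not_lt.2 ((le_zpow_apply hab hg (sub_pos.2 hjk)).trans h1.le))
  exact le_antisymm (not_lt.1 (key hk hj)) (not_lt.1 (key hj hk))

theorem apply_ne_of_mem_Ioo {g : DiffOne s} {a b : s} (hg : g.1 a = b) {x : s}
    (hx : x ∈ Ioo a b) : g.1 x ≠ x := by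
  intro h
  have := g.2.1 hx.1
  rw [hg, h] at this
  exact lt_asymm this hx.2

/-- The triangular weight with maximum `1` at `0` and support `[-n, n]`. -/
noncomputable def tent (n : ℕ) (k : ℤ) : ℝ := max 0 (1 - |(k : ℝ)| / (n + 1))

theorem tent_zero (n : ℕ) : tent n 0 = 1 := by simp [tent]

theorem tent_eq_zero {n : ℕ} {k : ℤ} (hk : k ∉ Finset.Icc (-(n : ℤ)) n) : tent n k = 0 := by
  have h : (n : ℤ) + 1 ≤ |k| := by
    rw [Finset.mem_Icc, ← abs_le] at hk
    lia
  have h' : (n : ℝ) + 1 ≤ |(k : ℝ)| := by exact_mod_cast h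
  refine max_eq_left ?_
  rw [sub_nonpos, one_le_div (by positivity)]
  exact h'

theorem abs_tent_sub_le (n : ℕ) (k : ℤ) : |tent n (k - 1) - tent n k| ≤ 1 / (n + 1) := by
  refine (abs_max_sub_max_le_max _ _ _ _).trans ?_
  have hn : (0 : ℝ) < n + 1 := by positivity
  refine max_le (by simp; positivity) ?_
  have : 1 - |((k - 1 : ℤ) : ℝ)| / (n + 1) - (1 - |(k : ℝ)| / (n + 1))
    = (|(k : ℝ)| - |((k - 1 : ℤ) : ℝ)|) / (n + 1) := by ring
  rw [this, abs_div, abs_of_pos hn]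
  gcongr
  refine (abs_abs_sub_abs_le _ _).trans ?_
  push_cast
  simp

/-- A function supported in a fundamental domain of `g` extends along the orbits of `g` to an
almost invariant function. -/
theorem exists_almost_invariant [OrdConnected s] (g : DiffOne s) {a b : s} (hab : a < b)
    (hg : g.1 a = b) {η : s → ℝ} (hc : Continuous η)
    (hη : ∀ x, g.1 x ≠ x → x ∉ Ioo a b → η x = 0) {ε : ℝ} (hε : 0 < ε) :
    ∃ ψ : s → ℝ, Continuous ψ ∧ (∀ x, g.1 x = x → ψ x = η x) ∧ (∀ x ∈ Icc a b, ψ x = η x) ∧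
      ∀ x, |ψ (g.1 x) - ψ x| ≤ ε := by
  classical
  have ha : η a = 0 := hη a (by rw [hg]; exact hab.ne') fun h => lt_irrefl _ h.1
  have hb : η b = 0 := hη b
    (by intro h; rw [← hg] at h; exact hab.ne' (hg ▸ g.1.injective h)) fun h => lt_irrefl _ h.2
  set v : s → ℝ := (Icc a b).indicator η with hv
  have hv0 : ∀ x, x ∉ Ioo a b → v x = 0 := by
    intro x hx
    by_cases h : x ∈ Icc a b
    · rw [hv, indicator_of_mem h]
      rcases h.1.eq_or_lt with rfl | h1
      · exact ha
      · rcases h.2.eq_or_lt with rfl | h2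
        · exact hb
        · exact absurd ⟨h1, h2⟩ hx
    · exact indicator_of_notMem h _
  have hvI : ∀ x ∈ Icc a b, v x = η x := fun x hx => indicator_of_mem hx _
  have hvc : Continuous v := by
    refine continuous_indicator (fun x hx => ?_) hc.continuousOn
    have h1 : x ∉ Ioo a b := fun h =>
      hx.2 (interior_maximal (s := Icc a b) Ioo_subset_Icc_self isOpen_Ioo h)
    have h2 : x ∈ closure (Icc a b) := hx.1
    rw [isClosed_Icc.closure_eq] at h2
    rw [← hvI x h2, hv0 x h1]
  obtain ⟨B, hB⟩ : ∃ B, ∀ x, |v x| ≤ B := by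
    have hK : IsCompact (Icc a b) := by
      rw [Subtype.isCompact_iff, show Subtype.val '' Icc a b = Icc (a : ℝ) b from ?_]
      · exact isCompact_Icc
      · exact Set.image_subtype_val_Icc a b
    obtain ⟨B, hB⟩ := hK.exists_bound_of_continuousOn hvc.continuousOn
    refine ⟨max B 0, fun x => ?_⟩
    by_cases h : x ∈ Icc a b
    · exact (hB x h).trans (le_max_left _ _)
    · rw [hv, indicator_of_notMem h, abs_zero]; exact le_max_right _ _
  have hB0 : 0 ≤ B := (abs_nonneg _).trans (hB a)
  obtain ⟨n, hn⟩ := exists_nat_gt (B / ε)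
  -- One step along an orbit shifts the index of the weight by one, which changes it by at most `1 /
  -- (n + 1)`; hence `n > B / ε`.
  set W : s → ℝ := fun x => ∑ k ∈ Finset.Icc (-(n : ℤ)) n, tent n k * v ((g ^ k).1 x) with hW
  have hWc : Continuous W := continuous_finsetSum _ fun k _ =>
    continuous_const.mul (hvc.comp (g ^ k).continuous_coe)
  have hW1 : ∀ x k, (g ^ k).1 x ∈ Ioo a b → W x = tent n k * v ((g ^ k).1 x) := by
    intro x k hk
    refine Finset.sum_eq_single k (fun j _ hjk => ?_) (fun h => by rw [tent_eq_zero h, zero_mul])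
    rw [hv0 _ fun hj => hjk (eq_of_zpow_apply_mem_Ioo hab hg hj hk), mul_zero]
  have hW0 : ∀ x, (∀ k : ℤ, (g ^ k).1 x ∉ Ioo a b) → W x = 0 := by
    intro x hx
    exact Finset.sum_eq_zero fun k _ => by rw [hv0 _ (hx k), mul_zero]
  have hfix : ∀ x, g.1 x = x → v x = 0 ∧ W x = 0 := by
    intro x hx
    have h1 : x ∉ Ioo a b := fun h => apply_ne_of_mem_Ioo hg h hx
    exact ⟨hv0 x h1, hW0 x fun k => by rwa [zpow_apply_eq_self g hx]⟩
  -- The term `η - v` vanishes off the fixed points, and `v` and `W` vanish on them: this function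
  -- is `W` on moved points and `η` on fixed points.
  refine ⟨fun x => η x - v x + W x, (hc.sub hvc).add hWc, ?_, ?_, ?_⟩
  · intro x hx
    simp [hfix x hx]
  · intro x hx
    have : W x = v x := by
      by_cases h : x ∈ Ioo a b
      · simpa [tent_zero] using hW1 x 0 (by simpa using h)
      · rw [hv0 x h]
        refine hW0 x fun k => ?_
        rcases hx.1.eq_or_lt with rfl | h1
        · exact zpow_apply_notMem_Ioo hab hg k
        · rcases hx.2.eq_or_lt with rfl | h2
          · have := zpow_apply_notMem_Ioo hab hg (k + 1)
            rwa [zpow_add_apply, zpow_one, hg] at this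
          · exact absurd ⟨h1, h2⟩ h
    simp only [this, sub_add_cancel]
  · intro x
    have h1 : ∀ x, g.1 x ≠ x → η x - v x = 0 := by
      intro x hx
      by_cases h : x ∈ Ioo a b
      · rw [hvI x (Ioo_subset_Icc_self h), sub_self]
      · rw [hv0 x h, hη x hx h, sub_self]
    by_cases hx : g.1 x = x
    · simp [hx, hε.le]
    · simp only [h1 x hx, h1 (g.1 x) (g.1.injective.ne hx), zero_add]
      by_cases hk : ∃ k : ℤ, (g ^ k).1 x ∈ Ioo a b
      · obtain ⟨k, hk⟩ := hk
        have h2 : (g ^ (k - 1)).1 (g.1 x) = (g ^ k).1 x := by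
          conv_rhs => rw [← sub_add_cancel k 1, zpow_add_apply, zpow_one]
        rw [hW1 x k hk, hW1 (g.1 x) (k - 1) (by rwa [h2]), h2, ← sub_mul, abs_mul]
        calc _ ≤ 1 / ((n : ℝ) + 1) * B :=
              mul_le_mul (abs_tent_sub_le n k) (hB _) (abs_nonneg _) (by positivity)
          _ ≤ ε := by
              rw [div_lt_iff₀ hε] at hn
              rw [one_div_mul_eq_div, div_le_iff₀ (by positivity)]
              nlinarith
      · push Not at hk
        rw [hW0 x hk, hW0 (g.1 x) fun k => ?_]
        · simpa using hε.le
        · have := hk (k + 1)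
          rwa [zpow_add_apply, zpow_one] at this

end Cohomology

/-! ### Nested families: finite induction and countability -/

section Nested

variable {s : Set ℝ}

/-- Passing to the inverse when necessary lets every generator move its fundamental domain to the
right. -/
theorem IsFundamentalDomain.exists_eq_Icc {g : DiffOne s} {I : Set s}
    (h : g.IsFundamentalDomain I) :
    ∃ (g' : DiffOne s) (a b : s), (g' = g ∨ g' = g⁻¹) ∧ a < b ∧ g'.1 a = b ∧ I = Icc a b := by
  obtain ⟨x, ⟨hx, rfl⟩ | ⟨hx, rfl⟩⟩ := h
  · exact ⟨g, x, g.1 x, Or.inl rfl, hx, rfl, rfl⟩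
  · exact ⟨g⁻¹, g.1 x, x, Or.inr rfl, hx, g.1.symm_apply_apply x, rfl⟩

theorem apply_eq_self_iff_of_eq_or_eq_inv {g g' : DiffOne s} (h : g' = g ∨ g' = g⁻¹) (x : s) :
    g'.1 x = x ↔ g.1 x = x := by
  rcases h with rfl | rfl
  · rfl
  · exact inv_apply_eq_self_iff g x

theorem apply_ne_of_mem_Ioo_apply {g : DiffOne s} {b x : s}
    (hx : x ∈ Ioo b (g.1 b)) : g.1 x ≠ x := by
  intro h
  have := g.2.1 hx.1
  rw [h] at this
  exact lt_asymm this hx.2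

theorem lt_apply_of_lt {g : DiffOne s} {a b : s} (hab : a < b) (hg : g.1 a = b) :
    b < g.1 b := by
  have := g.2.1 hab
  rwa [hg] at this

/-- A moved end point would have its image and its preimage on opposite sides, both in the support,
so one of them would leave the interval. -/
theorem mem_Ioo_of_supp_subset_Icc {g : DiffOne s} {a b x : s} (h : g.supp ⊆ Icc a b)
    (hx : g.1 x ≠ x) : x ∈ Ioo a b := by
  obtain ⟨z, rfl⟩ := g.1.surjective x
  have hz : g.1 z ≠ z := fun hz => hx (by rw [hz, hz])
  have h1 := h (mem_supp hx)
  have h2 := h (mem_supp (g.1.injective.ne hx))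
  have h3 := h (mem_supp hz)
  refine ⟨lt_of_le_of_ne h1.1 fun ha => hx ?_, lt_of_le_of_ne h1.2 fun hb => hx ?_⟩
  · rw [← ha] at h2 ⊢
    exact le_antisymm ((g.2.1.monotone h3.1).trans_eq ha.symm) h2.1
  · rw [hb] at h2 ⊢
    exact le_antisymm h2.2 (hb.symm.trans_le (g.2.1.monotone h3.2))

variable [OrdConnected s]

/-- A finite nested family, with arbitrary prescribed almost-coboundaries. -/
theorem exists_approx_transfer_finset {ι : Type*} {f : ι → DiffOne s} {I : ι → Set s}
    (hn : NestedFundamentalDomains f I) (hK : ∀ i, IsCompact (f i).supp) (S : Finset ι)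
    (u : ι → s → ℝ) (hc : ∀ i ∈ S, Continuous (u i))
    (hu : ∀ i ∈ S, ∀ x, (f i).1 x = x → u i x = 0) {ε : ℝ} (hε : 0 < ε) :
    ∃ φ : s → ℝ, Continuous φ ∧ (∀ x, (∀ i ∈ S, (f i).1 x = x) → φ x = 0) ∧
      ∀ i ∈ S, ∀ x, |φ ((f i).1 x) - φ x - u i x| ≤ ε := by
  classical
  choose g a b hgf hab hg hI using fun i => (hn.1 i).exists_eq_Icc
  have hfix : ∀ i x, (g i).1 x = x ↔ (f i).1 x = x := fun i x =>
    apply_eq_self_iff_of_eq_or_eq_inv (hgf i) x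
  induction S using Finset.strongInduction generalizing u ε with
  | H S ih =>
  rcases S.eq_empty_or_nonempty with rfl | hS
  · exact ⟨fun _ => 0, continuous_const, fun _ _ => rfl, by simp⟩
  -- By maximality the support of `f m` fits in no other `I i`: it contains `a m` and the image of
  -- `b m`, which lie further apart than the ends of `I m`.
  obtain ⟨m, hm, hmax⟩ := S.exists_max_image (fun i => (b i : ℝ) - a i) hS
  have hnest : ∀ i ∈ S, i ≠ m → (f i).supp ⊆ Icc (a m) (b m) ∨
      ∀ x, (f i).1 x = x ∨ (f m).1 x = x := by
    intro i hi him
    rcases hn.2 i m him with h | h | h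
    · exact Or.inl (hI m ▸ h)
    · rw [hI i] at h
      have h1 : a m ∈ Icc (a i) (b i) := h (mem_supp fun hx => by
        rw [← hfix, hg] at hx; exact (hab m).ne' hx)
      have h2 : (g m).1 (b m) ∈ Icc (a i) (b i) := h (mem_supp fun hx => by
        rw [← hfix] at hx
        exact (lt_apply_of_lt (hab m) (hg m)).ne' ((g m).1.injective hx))
      have h3 : (b m : ℝ) < (g m).1 (b m) := lt_apply_of_lt (hab m) (hg m)
      have h4 : (a i : ℝ) ≤ a m := h1.1
      have h5 : ((g m).1 (b m) : ℝ) ≤ b i := h2.2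
      have := hmax i hi
      linarith
    · right
      intro x
      by_contra hx
      push Not at hx
      have : x ∈ interior (f i).supp ∩ interior (f m).supp :=
        ⟨mem_interior_supp hx.1, mem_interior_supp hx.2⟩
      rw [h] at this
      exact this
  obtain ⟨φ, hφc, hφ0, hφ⟩ := (f m).exists_approx_transfer (hK m) (hc m hm) (hu m hm) (half_pos hε)
  -- The remaining generators only have to correct what `φ` leaves of `u i`; this difference still
  -- vanishes at the fixed points of `f i`.
  obtain ⟨η, hηc, hη0, hη⟩ := ih (S.erase m) (Finset.erase_ssubset hm)
    (fun i x => u i x - (φ ((f i).1 x) - φ x))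
    (fun i hi => (hc i (Finset.mem_of_mem_erase hi)).sub
      ((hφc.comp (f i).continuous_coe).sub hφc))
    (fun i hi x hx => by simp [hu i (Finset.mem_of_mem_erase hi) x hx, hx]) hε
  obtain ⟨ψ, hψc, hψfix, hψI, hψ⟩ := (g m).exists_almost_invariant (hab m) (hg m) hηc
    (fun x hx hxI => by
      refine hη0 x fun i hi => ?_
      by_contra h
      rcases hnest i (Finset.mem_of_mem_erase hi) (Finset.ne_of_mem_erase hi) with h' | h'
      · exact hxI (mem_Ioo_of_supp_subset_Icc h' h)
      · exact hx ((hfix m x).2 ((h' x).resolve_left h))) (half_pos hε)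
  have hψf : ∀ x, |ψ ((f m).1 x) - ψ x| ≤ ε / 2 := by
    intro x
    rcases hgf m with h | h
    · rw [← h]; exact hψ x
    · have := hψ ((f m).1 x)
      rw [h, abs_sub_comm] at this
      rwa [show (f m)⁻¹.1 ((f m).1 x) = x from (f m).1.symm_apply_apply x] at this
  refine ⟨fun x => φ x + ψ x, hφc.add hψc, ?_, ?_⟩
  · intro x hx
    have h1 := hη0 x fun i hi => hx i (Finset.mem_of_mem_erase hi)
    simp only [hφ0 x (hx m hm), hψfix x ((hfix m x).2 (hx m hm)), h1, add_zero]
  · intro i hi x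
    by_cases him : i = m
    · subst him
      have h1 := abs_le.1 (hφ x)
      have h2 := abs_le.1 (hψf x)
      exact abs_le.2 ⟨by linarith [h1.1, h2.1], by linarith [h1.2, h2.2]⟩
    · have h1 := hη i (Finset.mem_erase.2 ⟨him, hi⟩) x
      by_cases hx : (f i).1 x = x
      · simp [hx, hu i hi x hx, hε.le]
      have hx' : (f i).1 ((f i).1 x) ≠ (f i).1 x := (f i).1.injective.ne hx
      -- Passing from `η` to `ψ` changes nothing on the points moved by `f i`.
      have h2 : ∀ y, (f i).1 y ≠ y → ψ y = η y := by
        intro y hy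
        rcases hnest i hi him with h' | h'
        · exact hψI y (h' (mem_supp hy))
        · exact hψfix y ((hfix m y).2 ((h' y).resolve_left hy))
      simp only [h2 x hx, h2 _ hx']
      convert h1 using 2
      ring

/-- The open interval next to `I i` on the right, from `b i` to its image, consists of points moved
by `f i` and misses `I i`. By nestedness these intervals are pairwise disjoint, and the line is
separable. The interiors of the `I i` themselves would not do, as they can be nested. -/
theorem NestedFundamentalDomains.countable {ι : Type*} {f : ι → DiffOne s} {I : ι → Set s}
    (hn : NestedFundamentalDomains f I) : Countable ι := by
  choose g a b hgf hab hg hI using fun i => (hn.1 i).exists_eq_Icc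
  have hfix : ∀ i x, (g i).1 x = x ↔ (f i).1 x = x := fun i x =>
    apply_eq_self_iff_of_eq_or_eq_inv (hgf i) x
  have hU : ∀ i x, x ∈ Ioo (b i) ((g i).1 (b i)) → (f i).1 x ≠ x := fun i x hx h =>
    apply_ne_of_mem_Ioo_apply hx ((hfix i x).2 h)
  have hsub : ∀ i j x, (f i).supp ⊆ I j → x ∈ Ioo (b i) ((g i).1 (b i)) →
      x ∉ Ioo (b j) ((g j).1 (b j)) := by
    intro i j x h hxi hxj
    have := h (mem_supp (hU i x hxi))
    rw [hI j] at this
    exact absurd hxj.1 (not_lt.2 this.2)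
  have hd : (univ : Set ι).PairwiseDisjoint fun i => Ioo (b i) ((g i).1 (b i)) := by
    intro i _ j _ hij
    refine Set.disjoint_left.2 fun x hxi hxj => ?_
    rcases hn.2 i j hij with h | h | h
    · exact hsub i j x h hxi hxj
    · exact hsub j i x h hxj hxi
    · have : x ∈ interior (f i).supp ∩ interior (f j).supp :=
        ⟨mem_interior_supp (hU i x hxi), mem_interior_supp (hU j x hxj)⟩
      rw [h] at this
      exact this
  exact countable_univ_iff.1 (hd.countable_of_isOpen (fun _ _ => isOpen_Ioo)
    fun i _ => nonempty_Ioo.2 (lt_apply_of_lt (hab i) (hg i)))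

end Nested

/-! ### Chain rule, `C¹` convergence and interpolation -/

section Calculus

variable {s : Set ℝ}

theorem hasDerivWithinAt (g : DiffOne s) (x : s) :
    HasDerivWithinAt (extendById g.1) (g.D x) s x :=
  ((g.2.2.1.differentiableOn one_ne_zero) x x.2).hasDerivWithinAt

theorem D_eq (hs : UniqueDiffOn ℝ s) {g : DiffOne s} {x : s} {d : ℝ}
    (h : HasDerivWithinAt (extendById g.1) d s x) : g.D x = d :=
  h.derivWithin (hs x x.2)

theorem mapsTo_extendById (e : Equiv.Perm s) : MapsTo (extendById e) s s := by
  intro x hx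
  rw [extendById_coe e ⟨x, hx⟩]
  exact (e ⟨x, hx⟩).2

theorem D_mul (hs : UniqueDiffOn ℝ s) (g k : DiffOne s) (x : s) :
    (g * k).D x = g.D (k.1 x) * k.D x := by
  have h1 := g.hasDerivWithinAt (k.1 x)
  rw [← extendById_coe] at h1
  refine D_eq hs ((h1.comp (x : ℝ) (k.hasDerivWithinAt x) (mapsTo_extendById k.1)).congr ?_ ?_)
  · intro y hy
    rw [Function.comp_apply, extendById_coe k.1 ⟨y, hy⟩, extendById_coe, extendById_coe _ ⟨y, hy⟩]
    rfl
  · rw [Function.comp_apply, extendById_coe, extendById_coe, extendById_coe]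
    rfl

theorem D_one (hs : UniqueDiffOn ℝ s) (x : s) : (1 : DiffOne s).D x = 1 := by
  refine D_eq hs ((_root_.hasDerivWithinAt_id (x : ℝ) s).congr ?_ ?_)
  · intro y hy
    rw [extendById_coe _ ⟨y, hy⟩]
    rfl
  · rw [extendById_coe]
    rfl

theorem D_inv_mul_D (hs : UniqueDiffOn ℝ s) (g : DiffOne s) (x : s) :
    (g⁻¹).D (g.1 x) * g.D x = 1 := by
  rw [← D_mul hs, inv_mul_cancel, D_one hs]

theorem D_pos (hs : UniqueDiffOn ℝ s) (g : DiffOne s) (x : s) : 0 < g.D x := by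
  have hm : MonotoneOn (extendById g.1) s := by
    intro y hy z hz hyz
    rw [extendById_coe _ ⟨y, hy⟩, extendById_coe _ ⟨z, hz⟩]
    exact g.2.1.monotone (show (⟨y, hy⟩ : s) ≤ ⟨z, hz⟩ from hyz)
  refine lt_of_le_of_ne hm.derivWithin_nonneg fun h => ?_
  have h' : g.D x = 0 := h.symm
  simpa [h'] using D_inv_mul_D hs g x

theorem continuous_D (hs : UniqueDiffOn ℝ s) (g : DiffOne s) : Continuous g.D :=
  (g.2.2.1.continuousOn_derivWithin hs le_rfl).domRestrict

/-- Mean value inequality for `k - id`, which vanishes at `q`. It turns convergence of derivatives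
into uniform convergence. -/
theorem abs_apply_sub_le [OrdConnected s] {k : DiffOne s} {ε : ℝ}
    (h : ∀ x, |k.D x - 1| ≤ ε) {q : s} (hq : k.1 q = q) (y : s) :
    |(k.1 y : ℝ) - y| ≤ ε * |(y : ℝ) - q| := by
  have hcv : Convex ℝ s := OrdConnected.convex inferInstance
  have := hcv.norm_image_sub_le_of_norm_hasDerivWithin_le
    (f := fun x => extendById k.1 x - x) (f' := fun x => derivWithin (extendById k.1) s x - 1)
    (C := ε) (fun x hx => (k.hasDerivWithinAt ⟨x, hx⟩).sub (_root_.hasDerivWithinAt_id x s))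
    (fun x hx => h ⟨x, hx⟩) q.2 y.2
  simpa only [extendById_coe, hq, sub_self, sub_zero, Real.norm_eq_abs] using this

theorem tendstoC1_one_iff (hs : UniqueDiffOn ℝ s) {α : Type*} {F : α → DiffOne s}
    {l : Filter α} : TendstoC1 F l 1 ↔ (∀ ε > 0, ∀ᶠ a in l, ∀ x, |((F a).1 x : ℝ) - x| < ε) ∧
      ∀ ε > 0, ∀ᶠ a in l, ∀ x, |(F a).D x - 1| < ε := by
  simp only [TendstoC1, Metric.tendstoUniformly_iff, D_one hs]
  simp only [dist_comm, Real.dist_eq]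
  rfl

theorem TendstoC1.comp_tendsto {α β : Type*} {F : α → DiffOne s} {l : Filter α} {g : DiffOne s}
    (h : TendstoC1 F l g) {t : β → α} {l' : Filter β} (ht : Tendsto t l' l) :
    TendstoC1 (fun b => F (t b)) l' g :=
  ⟨fun u hu => ht.eventually (h.1 u hu), fun u hu => ht.eventually (h.2 u hu)⟩

theorem TendstoC1.one_mul_one (hs : UniqueDiffOn ℝ s) {α : Type*} {F G : α → DiffOne s}
    {l : Filter α} (hF : TendstoC1 F l 1) (hG : TendstoC1 G l 1) :
    TendstoC1 (fun a => F a * G a) l 1 := by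
  rw [tendstoC1_one_iff hs] at *
  refine ⟨fun ε hε => ?_, fun ε hε => ?_⟩
  · filter_upwards [hF.1 _ (half_pos hε), hG.1 _ (half_pos hε)] with a h1 h2 x
    have h3 := h1 ((G a).1 x)
    have h4 : |((F a).1 ((G a).1 x) : ℝ) - x| ≤ _ :=
      abs_sub_le _ ((G a).1 x : ℝ) _
    exact h4.trans_lt (by linarith [h2 x])
  · have hδ : 0 < min (ε / 3) 1 := lt_min (by positivity) one_pos
    filter_upwards [hF.2 _ hδ, hG.2 _ hδ] with a h1 h2 x
    rw [D_mul hs]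
    have h3 := lt_min_iff.1 (h1 ((G a).1 x))
    have h4 := lt_min_iff.1 (h2 x)
    set p := (F a).D ((G a).1 x)
    set q := (G a).D x
    have h5 : p * q - 1 = (p - 1) * (q - 1) + (p - 1) + (q - 1) := by ring
    rw [h5]
    refine (abs_add_three _ _ _).trans_lt ?_
    rw [abs_mul]
    nlinarith [abs_nonneg (p - 1), abs_nonneg (q - 1)]

theorem TendstoC1.inv_one (hs : UniqueDiffOn ℝ s) {α : Type*} {F : α → DiffOne s}
    {l : Filter α} (hF : TendstoC1 F l 1) : TendstoC1 (fun a => (F a)⁻¹) l 1 := by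
  rw [tendstoC1_one_iff hs] at *
  refine ⟨fun ε hε => ?_, fun ε hε => ?_⟩
  · filter_upwards [hF.1 _ hε] with a h1 x
    obtain ⟨y, rfl⟩ := (F a).1.surjective x
    rw [show (F a)⁻¹.1 ((F a).1 y) = y from (F a).1.symm_apply_apply y, abs_sub_comm]
    exact h1 y
  · have hδ : 0 < min (ε / 2) (1 / 2) := lt_min (by positivity) (by norm_num)
    filter_upwards [hF.2 _ hδ] with a h1 x
    obtain ⟨y, rfl⟩ := (F a).1.surjective x
    have h2 := D_inv_mul_D hs (F a) y
    have h3 := lt_min_iff.1 (h1 y)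
    set p := (F a)⁻¹.D ((F a).1 y)
    set q := (F a).D y
    have h4 := abs_lt.1 h3.1
    have h5 := abs_lt.1 h3.2
    have hp : 0 < p := D_pos hs _ _
    have hp2 : p ≤ 2 := by nlinarith
    have h6 : p - 1 = p * (1 - q) := by linarith
    rw [h6, abs_mul, abs_of_pos hp, abs_sub_comm]
    nlinarith [abs_nonneg (q - 1)]

/-- The elements whose conjugates tend to the identity form a subgroup, so only generators need
checking. -/
theorem tendstoC1_conj_of_mem_closure (hs : UniqueDiffOn ℝ s) {α : Type*} {h : α → DiffOne s}
    {l : Filter α} {S : Set (DiffOne s)}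
    (hS : ∀ g ∈ S, TendstoC1 (fun a => h a * g * (h a)⁻¹) l 1) {g : DiffOne s}
    (hg : g ∈ Subgroup.closure S) : TendstoC1 (fun a => h a * g * (h a)⁻¹) l 1 := by
  induction hg using Subgroup.closure_induction with
  | mem g hg => exact hS g hg
  | one =>
    rw [tendstoC1_one_iff hs]
    simp only [mul_one, mul_inv_cancel, D_one hs, sub_self, abs_zero]
    refine ⟨fun ε hε => .of_forall fun a x => ?_, fun ε hε => .of_forall fun a x => hε⟩
    simpa using hε
  | mul g k _ _ ihg ihk =>
    have : (fun a => h a * (g * k) * (h a)⁻¹)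
        = fun a => (h a * g * (h a)⁻¹) * (h a * k * (h a)⁻¹) := by
      funext a; group
    rw [this]
    exact ihg.one_mul_one hs ihk
  | inv g _ ih =>
    have : (fun a => h a * g⁻¹ * (h a)⁻¹) = fun a => (h a * g * (h a)⁻¹)⁻¹ := by
      funext a; group
    rw [this]
    exact ih.inv_one hs

/-- A sequence of continuous functions is joined by a path, affine between consecutive terms. -/
theorem exists_continuous_interpolation {X : Type*} [TopologicalSpace X] {φ : ℕ → X → ℝ}
    (hφ : ∀ n, Continuous (φ n)) :
    ∃ Φ : ℝ → X → ℝ, Continuous (fun p : ℝ × X => Φ p.1 p.2) ∧ ∀ τ, ∃ θ ∈ Icc (0 : ℝ) 1, ∀ x,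
      Φ τ x = (1 - θ) * φ ⌊τ⌋₊ x + θ * φ (⌊τ⌋₊ + 1) x := by
  set c : ℝ → ℝ := fun t => max 0 (min 1 t) with hc
  have hcc : Continuous c := continuous_const.max (continuous_const.min continuous_id)
  set Ψ : ℕ → ℝ → X → ℝ := fun N τ x =>
    φ 0 x + ∑ n ∈ Finset.range N, c (τ - n) * (φ (n + 1) x - φ n x) with hΨ
  have hΨN : ∀ τ x N, ⌊τ⌋₊ + 1 ≤ N → Ψ (⌊τ⌋₊ + 1) τ x = Ψ N τ x := by
    intro τ x N hN
    simp only [hΨ]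
    congr 1
    refine Finset.sum_subset (Finset.range_subset_range.2 hN) fun n _ hn => ?_
    rw [Finset.mem_range, not_lt] at hn
    have h1 : τ < n := (Nat.lt_floor_add_one τ).trans_le (by exact_mod_cast hn)
    have h2 : c (τ - n) = 0 := max_eq_left ((min_le_right _ _).trans (by linarith))
    rw [h2, zero_mul]
  -- All later terms of the sum vanish, so near a given time a fixed number of terms suffices,
  -- whence continuity.
  refine ⟨fun τ => Ψ (⌊τ⌋₊ + 1) τ, ?_, fun τ => ⟨c (τ - ⌊τ⌋₊), ⟨le_max_left _ _, ?_⟩, fun x => ?_⟩⟩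
  · refine continuous_iff_continuousAt.2 fun p => ?_
    have hN : Continuous fun q : ℝ × X => Ψ (⌊p.1⌋₊ + 1) q.1 q.2 := by
      refine ((hφ 0).comp continuous_snd).add (continuous_finsetSum _ fun n _ => ?_)
      exact (hcc.comp (continuous_fst.sub continuous_const)).mul
        (((hφ _).comp continuous_snd).sub ((hφ _).comp continuous_snd))
    refine hN.continuousAt.congr ?_
    have : ∀ᶠ q : ℝ × X in 𝓝 p, q.1 < (⌊p.1⌋₊ + 1 : ℕ) :=
      continuous_fst.continuousAt.eventually_lt continuousAt_const
        (by exact_mod_cast Nat.lt_floor_add_one p.1)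
    filter_upwards [this] with q hq
    exact (hΨN _ _ _ ((Nat.floor_lt' (Nat.succ_ne_zero _)).2 hq)).symm
  · exact max_le zero_le_one (min_le_left _ _)
  · have h1 : ∀ n ∈ Finset.range ⌊τ⌋₊, c (τ - n) * (φ (n + 1) x - φ n x) = φ (n + 1) x - φ n x := by
      intro n hn
      have h2 : n + 1 ≤ ⌊τ⌋₊ := Finset.mem_range.1 hn
      have h3 : ((n + 1 : ℕ) : ℝ) ≤ τ := (Nat.le_floor_iff' (Nat.succ_ne_zero n)).1 h2
      push_cast at h3
      have h4 : c (τ - n) = 1 := by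
        simp only [hc]
        rw [min_eq_left (by linarith), max_eq_right zero_le_one]
      rw [h4, one_mul]
    simp only [hΨ]
    rw [Finset.sum_range_succ, Finset.sum_congr rfl h1, Finset.sum_range_sub (fun n => φ n x)]
    ring

end Calculus

/-! ### From approximate coboundaries to conjugating paths -/

section Paths

variable {s : Set ℝ} [OrdConnected s]

/-- The logarithmic derivatives of a nested family without hyperbolic fixed points are limits of
coboundaries. -/
theorem exists_seq_approx_transfer (hs : UniqueDiffOn ℝ s) {ι : Type*} {f : ι → DiffOne s}
    {I : ι → Set s} (hn : NestedFundamentalDomains f I) (hK : ∀ i, IsCompact (f i).supp)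
    (hf : ∀ i, (f i).WithoutHyperbolicFixedPoint) :
    ∃ φ : ℕ → s → ℝ, (∀ n, Continuous (φ n)) ∧ (∀ n x, φ n x ≤ 0) ∧
      (∀ n, ∃ B, ∀ x, B ≤ φ n x) ∧ ∀ i, ∃ N, ∀ n ≥ N, ∀ x,
        |φ n ((f i).1 x) - φ n x + Real.log ((f i).D x)| ≤ 1 / (n + 1) := by
  have := hn.countable
  obtain ⟨e, he⟩ := Countable.exists_injective_nat ι
  have hfin : ∀ n, {i | e i ≤ n}.Finite := fun n => (finite_Iic n).preimage he.injOn
  have key : ∀ n : ℕ, ∃ φ : s → ℝ, Continuous φ ∧ (∀ x, φ x ≤ 0) ∧ (∃ B, ∀ x, B ≤ φ x) ∧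
      ∀ i, e i ≤ n → ∀ x, |φ ((f i).1 x) - φ x + Real.log ((f i).D x)| ≤ 1 / (n + 1) := by
    intro n
    obtain ⟨φ, hφc, hφ0, hφ⟩ := exists_approx_transfer_finset hn hK (hfin n).toFinset
      (fun i x => -Real.log ((f i).D x))
      (fun i _ => (((f i).continuous_D hs).log fun x => (D_pos hs (f i) x).ne').neg)
      (fun i _ x hx => by simp [hf i x hx]) (ε := 1 / ((n : ℝ) + 1)) (by positivity)
    obtain ⟨B, hB⟩ : ∃ B, ∀ x, |φ x| ≤ B := by
      obtain ⟨B, hB⟩ := ((hfin n).toFinset.isCompact_biUnion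
        fun i _ => hK i).exists_bound_of_continuousOn hφc.continuousOn
      refine ⟨max B 0, fun x => ?_⟩
      by_cases hx : ∀ i ∈ (hfin n).toFinset, (f i).1 x = x
      · rw [hφ0 x hx, abs_zero]; exact le_max_right _ _
      · push Not at hx
        obtain ⟨i, hi, hx⟩ := hx
        exact (hB x (mem_biUnion hi (mem_supp hx))).trans (le_max_left _ _)
    -- Constants do not affect coboundaries; subtracting the bound makes the function nonpositive,
    -- as `HasPrimitives` requires.
    refine ⟨fun x => φ x - B, hφc.sub continuous_const, fun x => ?_, ⟨-B - B, fun x => ?_⟩,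
      fun i hi x => ?_⟩
    · linarith [(abs_le.1 (hB x)).2]
    · linarith [(abs_le.1 (hB x)).1]
    · convert hφ i (by simpa using hi) x using 2
      ring
  choose φ h1 h2 h3 h4 using key
  exact ⟨φ, h1, h2, h3, fun i => ⟨e i, fun n hn x => h4 n i hn x⟩⟩

/-- Every continuous path of bounded functions is, up to additive constants, the logarithm of the
derivative of a continuous path of diffeomorphisms, with a uniform control on compact sets. -/
def HasPrimitives (s : Set ℝ) : Prop :=
  ∀ φ : ℝ → s → ℝ, Continuous (fun p : ℝ × s => φ p.1 p.2) → (∀ τ x, φ τ x ≤ 0) →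
    (∀ τ, ∃ B, ∀ x, B ≤ φ τ x) → ∃ (h : ℝ → DiffOne s) (c : ℝ → ℝ),
      Continuous (fun p : ℝ × s => ((h p.1).1 p.2 : ℝ)) ∧ Continuous c ∧
      (∀ τ x, (h τ).D x = Real.exp (φ τ x + c τ)) ∧
      ∀ (K : Set s) (q : s), IsCompact K → ∃ M, ∀ τ, ∀ x ∈ K, |((h τ).1 x : ℝ) - (h τ).1 q| ≤ M

theorem exists_path_tendstoC1_one (hs : UniqueDiffOn ℝ s) (hP : HasPrimitives s)
    {ι : Type*} {f : ι → DiffOne s} {I : ι → Set s} (hn : NestedFundamentalDomains f I)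
    (hK : ∀ i, IsCompact (f i).supp) (hf : ∀ i, (f i).WithoutHyperbolicFixedPoint)
    (hq : ∀ i, ∃ q, (f i).1 q = q) :
    ∃ h : ℝ → DiffOne s, Continuous (fun p : ℝ × s => ((h p.1).1 p.2 : ℝ)) ∧
      Continuous (fun p : ℝ × s => (h p.1).D p.2) ∧
      ∀ g ∈ Subgroup.closure (range f), TendstoC1 (fun τ => h τ * g * (h τ)⁻¹) atTop 1 := by
  obtain ⟨φ, hφc, hφ0, hφB, hφ⟩ := exists_seq_approx_transfer hs hn hK hf
  obtain ⟨Φ, hΦc, hΦ⟩ := exists_continuous_interpolation hφc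
  obtain ⟨h, c, hhc, hcc, hD, hM⟩ := hP Φ hΦc
    (fun τ x => by
      obtain ⟨θ, hθ, hx⟩ := hΦ τ
      rw [hx]
      exact add_nonpos (mul_nonpos_of_nonneg_of_nonpos (sub_nonneg.2 hθ.2) (hφ0 _ _))
        (mul_nonpos_of_nonneg_of_nonpos hθ.1 (hφ0 _ _)))
    (fun τ => by
      obtain ⟨θ, hθ, hx⟩ := hΦ τ
      obtain ⟨B, hB⟩ := hφB ⌊τ⌋₊
      obtain ⟨B', hB'⟩ := hφB (⌊τ⌋₊ + 1)
      refine ⟨(1 - θ) * B + θ * B', fun x => ?_⟩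
      rw [hx]
      exact add_le_add (mul_le_mul_of_nonneg_left (hB x) (sub_nonneg.2 hθ.2))
        (mul_le_mul_of_nonneg_left (hB' x) hθ.1))
  refine ⟨h, hhc, ?_, fun g hg => tendstoC1_conj_of_mem_closure hs ?_ hg⟩
  · simp only [hD]
    exact (hΦc.add (hcc.comp continuous_fst)).rexp
  rintro _ ⟨i, rfl⟩
  have hDconj : ∀ τ y, ∃ x, y = (h τ).1 x ∧ (h τ * f i * (h τ)⁻¹).D y =
      Real.exp (Φ τ ((f i).1 x) - Φ τ x + Real.log ((f i).D x)) := by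
    intro τ y
    obtain ⟨x, rfl⟩ := (h τ).1.surjective y
    refine ⟨x, rfl, ?_⟩
    have hx : (h τ)⁻¹.1 ((h τ).1 x) = x := (h τ).1.symm_apply_apply x
    have h1 := D_inv_mul_D hs (h τ) x
    rw [D_mul hs, D_mul hs, hx, hD]
    rw [hD, ← eq_div_iff (Real.exp_pos _).ne', one_div, ← Real.exp_neg] at h1
    rw [h1, Real.exp_add (_ - _), Real.exp_log (D_pos hs _ _),
      show Φ τ ((f i).1 x) - Φ τ x = Φ τ ((f i).1 x) + c τ + -(Φ τ x + c τ) by ring,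
      Real.exp_add (_ + _) (-_)]
    ring
  have hDlim : ∀ ε > 0, ∀ᶠ τ in atTop, ∀ y, |(h τ * f i * (h τ)⁻¹).D y - 1| ≤ ε := by
    intro ε hε
    obtain ⟨N, hN⟩ := hφ i
    obtain ⟨m, hm⟩ := exists_nat_gt (2 / ε)
    filter_upwards [eventually_ge_atTop ((max N m : ℕ) : ℝ)] with τ hτ y
    have hτ' : max N m ≤ ⌊τ⌋₊ := Nat.le_floor hτ
    obtain ⟨x, -, hx⟩ := hDconj τ y
    rw [hx]
    obtain ⟨θ, hθ, hΦx⟩ := hΦ τ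
    have h1 := hN ⌊τ⌋₊ ((le_max_left _ _).trans hτ') x
    have h2 := hN (⌊τ⌋₊ + 1) ((le_max_left _ _).trans (hτ'.trans (Nat.le_succ _))) x
    set n := ⌊τ⌋₊
    have hnm : (m : ℝ) ≤ n := by exact_mod_cast (le_max_right _ _).trans hτ'
    have hn0 : (0 : ℝ) < n + 1 := by positivity
    have h3 : 1 / (((n + 1 : ℕ) : ℝ) + 1) ≤ 1 / ((n : ℝ) + 1) := by
      push_cast
      gcongr
      linarith
    -- The error is affine in the function, so interpolation averages the errors at `n` and `n + 1`.
    have h4 : |Φ τ ((f i).1 x) - Φ τ x + Real.log ((f i).D x)| ≤ 1 / ((n : ℝ) + 1) := by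
      rw [hΦx, hΦx]
      have h5 := abs_le.1 h1
      have h6 := abs_le.1 (h2.trans h3)
      have hθ' := sub_nonneg.2 hθ.2
      rw [abs_le]
      constructor
      · nlinarith [mul_le_mul_of_nonneg_left h5.1 hθ', mul_le_mul_of_nonneg_left h6.1 hθ.1]
      · nlinarith [mul_le_mul_of_nonneg_left h5.2 hθ', mul_le_mul_of_nonneg_left h6.2 hθ.1]
    have h7 : 1 / ((n : ℝ) + 1) ≤ 1 := by
      rw [div_le_one hn0]
      linarith [(Nat.cast_nonneg n : (0 : ℝ) ≤ n)]
    refine (Real.abs_exp_sub_one_le (h4.trans h7)).trans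
      ((mul_le_mul_of_nonneg_left h4 zero_le_two).trans ?_)
    rw [mul_one_div, div_le_iff₀ hn0]
    rw [div_lt_iff₀ hε] at hm
    nlinarith
  obtain ⟨q, hq⟩ := hq i
  obtain ⟨M, hM⟩ := hM (f i).supp q (hK i)
  refine (tendstoC1_one_iff hs).2 ⟨fun ε hε => ?_, fun ε hε => ?_⟩
  · have hM1 : 0 < |M| + 1 := by positivity
    filter_upwards [hDlim (ε / (|M| + 1)) (by positivity)] with τ hτ y
    obtain ⟨x, rfl⟩ := (h τ).1.surjective y
    have hconj : ∀ x, (h τ * f i * (h τ)⁻¹).1 ((h τ).1 x) = (h τ).1 ((f i).1 x) := fun x =>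
      congrArg (fun z => (h τ).1 ((f i).1 z)) ((h τ).1.symm_apply_apply x)
    by_cases hx : (f i).1 x = x
    · rw [hconj, hx]
      simpa using hε
    -- The conjugate fixes `h τ q`, and its moved points lie in the image of the support, within `M`
    -- of `h τ q` for all `τ`.
    · have h1 := abs_apply_sub_le hτ (q := (h τ).1 q) (by rw [hconj, hq]) ((h τ).1 x)
      refine h1.trans_lt ?_
      have h2 := (hM τ x (mem_supp hx)).trans (le_abs_self M)
      rw [div_mul_eq_mul_div, div_lt_iff₀ hM1]
      nlinarith
  · filter_upwards [hDlim (ε / 2) (half_pos hε)] with τ hτ y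
    exact (hτ y).trans_lt (half_lt_self hε)

/-- The sequence samples the path at integers; the isotopy runs through it at time `1 / (1 - t)`. -/
theorem isC1CloseToId_and_isIsotopic (hs : UniqueDiffOn ℝ s) (hP : HasPrimitives s)
    {ι : Type*} {f : ι → DiffOne s} {I : ι → Set s} (hn : NestedFundamentalDomains f I)
    (hK : ∀ i, IsCompact (f i).supp) (hf : ∀ i, (f i).WithoutHyperbolicFixedPoint)
    (hq : ∀ i, ∃ q, (f i).1 q = q) :
    IsC1CloseToId (Subgroup.closure (range f)) ∧
      IsIsotopicByConjugacyToId (Subgroup.closure (range f)) := by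
  obtain ⟨h, hc, hD, hlim⟩ := exists_path_tendstoC1_one hs hP hn hK hf hq
  have ht : ContinuousOn (fun p : ℝ × s => ((1 - p.1)⁻¹, p.2)) (Ico 0 1 ×ˢ univ) := by
    refine ContinuousOn.prodMk (ContinuousOn.inv₀ (by fun_prop) fun p hp => ?_) (by fun_prop)
    exact (sub_pos.2 hp.1.2).ne'
  refine ⟨⟨fun n => h n, fun g hg => (hlim g hg).comp_tendsto tendsto_natCast_atTop_atTop⟩,
    fun t => h (1 - t)⁻¹, hc.comp_continuousOn ht, hD.comp_continuousOn ht,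
    fun g hg => (hlim g hg).comp_tendsto (tendsto_inv_nhdsGT_zero.comp ?_)⟩
  have h1 : Tendsto (fun t : ℝ => 1 - t) (𝓝[<] 1) (𝓝 0) := by
    have : Tendsto (fun t : ℝ => 1 - t) (𝓝 1) (𝓝 (1 - 1)) := tendsto_const_nhds.sub tendsto_id
    rw [sub_self] at this
    exact this.mono_left nhdsWithin_le_nhds
  exact tendsto_nhdsWithin_iff.2 ⟨h1, by
    filter_upwards [self_mem_nhdsWithin] with t ht using sub_pos.2 (mem_Iio.1 ht)⟩

end Paths

/-! ### Diffeomorphisms with prescribed logarithmic derivative -/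

section Primitives

/-- The primitive of `exp ∘ Φ` vanishing at `0`. -/
noncomputable def expPrimitive (Φ : ℝ → ℝ) (x : ℝ) : ℝ := ∫ y in (0 : ℝ)..x, Real.exp (Φ y)

section expPrimitive

variable {Φ : ℝ → ℝ}

theorem hasDerivAt_expPrimitive (hΦ : Continuous Φ) (x : ℝ) :
    HasDerivAt (expPrimitive Φ) (Real.exp (Φ x)) x :=
  hΦ.rexp.integral_hasStrictDerivAt 0 x |>.hasDerivAt

theorem contDiff_expPrimitive (hΦ : Continuous Φ) : ContDiff ℝ 1 (expPrimitive Φ) := by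
  rw [contDiff_one_iff_deriv]
  refine ⟨fun x => (hasDerivAt_expPrimitive hΦ x).differentiableAt, ?_⟩
  rw [funext fun x => (hasDerivAt_expPrimitive hΦ x).deriv]
  exact hΦ.rexp

theorem strictMono_expPrimitive (hΦ : Continuous Φ) : StrictMono (expPrimitive Φ) :=
  strictMono_of_deriv_pos fun x => by
    rw [(hasDerivAt_expPrimitive hΦ x).deriv]; exact Real.exp_pos _

/-- The derivative is at least `exp B`, so the primitive grows at least linearly in both directions.
-/
theorem surjective_expPrimitive (hΦ : Continuous Φ) {B : ℝ} (hB : ∀ x, B ≤ Φ x) :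
    Function.Surjective (expPrimitive Φ) := by
  have hm : Monotone fun x => expPrimitive Φ x - Real.exp B * x := by
    have hd : ∀ x, HasDerivAt (fun x => expPrimitive Φ x - Real.exp B * x)
        (Real.exp (Φ x) - Real.exp B * 1) x := fun x =>
      (hasDerivAt_expPrimitive hΦ x).sub ((hasDerivAt_id x).const_mul _)
    refine monotone_of_deriv_nonneg (fun x => (hd x).differentiableAt) fun x => ?_
    rw [(hd x).deriv, mul_one, sub_nonneg]
    exact Real.exp_le_exp.2 (hB x)
  have h0 : expPrimitive Φ 0 = 0 := intervalIntegral.integral_same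
  have hpos := Real.exp_pos B
  refine (contDiff_expPrimitive hΦ).continuous.surjective ?_ ?_
  · refine tendsto_atTop_mono' _ ?_ (tendsto_id.const_mul_atTop hpos)
    filter_upwards [eventually_ge_atTop 0] with x hx
    have := hm hx
    simp only [h0, mul_zero, sub_zero] at this
    exact sub_nonneg.1 this
  · refine tendsto_atBot_mono' _ ?_ (tendsto_id.const_mul_atBot hpos)
    filter_upwards [eventually_le_atBot 0] with x hx
    have := hm hx
    simp only [h0, mul_zero, sub_zero] at this
    exact sub_nonpos.1 this

theorem exists_diffOne_eq_expPrimitive {s : Set ℝ} (hs : UniqueDiffOn ℝ s) (hΦ : Continuous Φ)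
    {B : ℝ} (hB : ∀ x, B ≤ Φ x) (hmem : ∀ x, expPrimitive Φ x ∈ s ↔ x ∈ s) :
    ∃ h : DiffOne s, (∀ x, (h.1 x : ℝ) = expPrimitive Φ x) ∧ ∀ x, h.D x = Real.exp (Φ x) := by
  let F : ℝ ≃ₜ ℝ := (StrictMono.orderIsoOfSurjective _ (strictMono_expPrimitive hΦ)
    (surjective_expPrimitive hΦ hB)).toHomeomorph
  have hF : ∀ x, F x = expPrimitive Φ x := fun _ => rfl
  have hFs : ContDiff ℝ 1 F.symm := F.contDiff_symm_deriv
    (fun x => (Real.exp_pos (Φ x)).ne') (hasDerivAt_expPrimitive hΦ) (contDiff_expPrimitive hΦ)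
  let e : Equiv.Perm s := F.toEquiv.subtypeEquiv fun x => (hmem x).symm
  have he : ∀ x, (e x : ℝ) = expPrimitive Φ x := fun _ => rfl
  have hes : ∀ x, (e⁻¹ x : ℝ) = F.symm x := fun _ => rfl
  have h1 : EqOn (extendById e) (expPrimitive Φ) s := fun x hx => by
    rw [extendById_coe e ⟨x, hx⟩, he]
  refine ⟨⟨e, fun x y hxy => ?_, (contDiff_expPrimitive hΦ).contDiffOn.congr h1,
    hFs.contDiffOn.congr fun x hx => ?_⟩, he, fun x => ?_⟩
  · exact Subtype.coe_lt_coe.1 (strictMono_expPrimitive hΦ hxy)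
  · rw [extendById_coe e⁻¹ ⟨x, hx⟩, hes]
  · exact D_eq hs ((hasDerivAt_expPrimitive hΦ x).hasDerivWithinAt.congr h1 (h1 x.2))

theorem continuous_expPrimitive_uncurry {Φ : ℝ → ℝ → ℝ}
    (hΦ : Continuous fun p : ℝ × ℝ => Φ p.1 p.2) :
    Continuous fun p : ℝ × ℝ => expPrimitive (Φ p.1) p.2 := by
  refine intervalIntegral.continuous_parametric_intervalIntegral_of_continuous
    (f := fun (p : ℝ × ℝ) y => Real.exp (Φ p.1 y)) ?_ continuous_snd
  exact (hΦ.comp ((continuous_fst.comp continuous_fst).prodMk continuous_snd)).rexp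

end expPrimitive

/-- Since `φ ≤ 0`, the primitives are `1`-Lipschitz, which gives the bound on compact sets uniformly
in `τ`; no normalizing constant is needed. -/
theorem hasPrimitives_univ : HasPrimitives (univ : Set ℝ) := by
  intro φ hφ hφ0 hφB
  set Φ : ℝ → ℝ → ℝ := fun τ x => φ τ ⟨x, mem_univ x⟩
  have hΦ : Continuous fun p : ℝ × ℝ => Φ p.1 p.2 :=
    hφ.comp (continuous_fst.prodMk (continuous_snd.subtype_mk _))
  have hΦτ : ∀ τ, Continuous (Φ τ) := fun τ => hΦ.comp (Continuous.prodMk_right τ)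
  choose B hB using hφB
  choose h hh hD using fun τ => exists_diffOne_eq_expPrimitive uniqueDiffOn_univ (hΦτ τ)
    (fun x => hB τ ⟨x, mem_univ x⟩) (fun x => by simp)
  refine ⟨h, fun _ => 0, ?_, continuous_const, fun τ x => ?_, fun K q hK => ?_⟩
  · simp only [hh]
    exact (continuous_expPrimitive_uncurry hΦ).comp
      (continuous_fst.prodMk (continuous_subtype_val.comp continuous_snd))
  · rw [hD, add_zero]
  · obtain ⟨M, hM⟩ := hK.exists_bound_of_continuousOn
      (f := fun x : (univ : Set ℝ) => (x : ℝ) - q)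
      (continuous_subtype_val.sub continuous_const).continuousOn
    refine ⟨M, fun τ x hx => ?_⟩
    rw [hh, hh]
    refine le_trans ?_ (hM x hx)
    have := convex_univ.norm_image_sub_le_of_norm_hasDerivWithin_le (C := 1)
      (fun x _ => (hasDerivAt_expPrimitive (hΦτ τ) x).hasDerivWithinAt)
      (fun x _ => by
        rw [Real.norm_eq_abs, abs_of_pos (Real.exp_pos _), Real.exp_le_one_iff]
        exact hφ0 τ _) (mem_univ (q : ℝ)) (mem_univ (x : ℝ))
    simpa using this

theorem hasPrimitives_Icc : HasPrimitives (Icc (0 : ℝ) 1) := by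
  intro φ hφ _ hφB
  set Ψ : ℝ → ℝ → ℝ := fun τ x => φ τ (projIcc 0 1 zero_le_one x)
  have hΨ : Continuous fun p : ℝ × ℝ => Ψ p.1 p.2 :=
    hφ.comp (continuous_fst.prodMk ((continuous_projIcc (h := zero_le_one)).comp continuous_snd))
  have hΨτ : ∀ τ, Continuous (Ψ τ) := fun τ => hΨ.comp (Continuous.prodMk_right τ)
  have hpos : ∀ τ, 0 < expPrimitive (Ψ τ) 1 := fun τ => by
    have h := strictMono_expPrimitive (hΨτ τ) zero_lt_one
    rwa [expPrimitive, intervalIntegral.integral_same] at h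
  -- This constant rescales the primitive so that it fixes `1` as well as `0`, hence preserves
  -- `[0,1]`.
  set c : ℝ → ℝ := fun τ => -Real.log (expPrimitive (Ψ τ) 1)
  have hc : Continuous c := ((continuous_expPrimitive_uncurry hΨ).comp
    (Continuous.prodMk_left (1 : ℝ))).log (fun τ => (hpos τ).ne') |>.neg
  set Φ : ℝ → ℝ → ℝ := fun τ x => Ψ τ x + c τ
  have hΦ : Continuous fun p : ℝ × ℝ => Φ p.1 p.2 := hΨ.add (hc.comp continuous_fst)
  have hΦτ : ∀ τ, Continuous (Φ τ) := fun τ => hΦ.comp (Continuous.prodMk_right τ)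
  have h0 : ∀ τ, expPrimitive (Φ τ) 0 = 0 := fun τ => intervalIntegral.integral_same
  have h1 : ∀ τ, expPrimitive (Φ τ) 1 = 1 := fun τ => by
    have : expPrimitive (Φ τ) 1 = expPrimitive (Ψ τ) 1 * Real.exp (c τ) := by
      simp only [expPrimitive, Φ, Real.exp_add, intervalIntegral.integral_mul_const]
    rw [this, Real.exp_neg, Real.exp_log (hpos τ), mul_inv_cancel₀ (hpos τ).ne']
  choose B hB using hφB
  choose h hh hD using fun τ => exists_diffOne_eq_expPrimitive uniqueDiffOn_Icc_zero_one (hΦτ τ)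
    (B := B τ + c τ) (fun x => add_le_add_left (hB τ _) _) (fun x => by
      have hm := strictMono_expPrimitive (hΦτ τ)
      have h2 := hm.le_iff_le (a := 0) (b := x)
      have h3 := hm.le_iff_le (a := x) (b := 1)
      rw [h0] at h2
      rw [h1] at h3
      rw [mem_Icc, mem_Icc, h2, h3])
  refine ⟨h, c, ?_, hc, fun τ x => ?_, fun K q _ => ⟨1, fun τ x _ => ?_⟩⟩
  · simp only [hh]
    exact (continuous_expPrimitive_uncurry hΦ).comp
      (continuous_fst.prodMk (continuous_subtype_val.comp continuous_snd))
  · rw [hD]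
    simp only [Φ, Ψ, projIcc_val]
  · have h2 := ((h τ).1 x).2
    have h3 := ((h τ).1 q).2
    rw [abs_le]
    constructor <;> linarith [h2.1, h2.2, h3.1, h3.2]

theorem apply_zero (g : DiffOne (Icc (0 : ℝ) 1)) : g.1 ⟨0, by simp⟩ = ⟨0, by simp⟩ := by
  obtain ⟨z, hz⟩ := g.1.surjective ⟨0, by simp⟩
  refine le_antisymm (le_of_le_of_eq (g.2.1.monotone ?_) hz) (g.1 _).2.1
  exact z.2.1

theorem exists_apply_eq_self_of_isCompact {g : DiffOne (univ : Set ℝ)} (hK : IsCompact g.supp) :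
    ∃ q, g.1 q = q := by
  by_contra! h
  have h1 : g.supp = univ := eq_univ_of_forall fun x => mem_supp (h x)
  rw [h1, Subtype.isCompact_iff, image_univ, Subtype.range_coe] at hK
  exact noncompact_univ ℝ hK

theorem closure_range_Icc {ι : Type*} {f : ι → DiffOne (Icc (0 : ℝ) 1)}
    {I : ι → Set (Icc (0 : ℝ) 1)} (hf : ∀ i, (f i).WithoutHyperbolicFixedPoint)
    (hn : NestedFundamentalDomains f I) :
    IsC1CloseToId (Subgroup.closure (range f)) ∧
      IsIsotopicByConjugacyToId (Subgroup.closure (range f)) :=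
  isC1CloseToId_and_isIsotopic uniqueDiffOn_Icc_zero_one hasPrimitives_Icc hn
    (fun _ => isClosed_closure.isCompact) hf fun i => ⟨_, apply_zero (f i)⟩

theorem closure_range_univ {ι : Type*} {f : ι → DiffOne (univ : Set ℝ)}
    {I : ι → Set (univ : Set ℝ)} (hK : ∀ i, IsCompact (f i).supp)
    (hf : ∀ i, (f i).WithoutHyperbolicFixedPoint) (hn : NestedFundamentalDomains f I) :
    IsC1CloseToId (Subgroup.closure (range f)) ∧
      IsIsotopicByConjugacyToId (Subgroup.closure (range f)) :=
  isC1CloseToId_and_isIsotopic uniqueDiffOn_univ hasPrimitives_univ hn hK hf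
    fun i => exists_apply_eq_self_of_isCompact (hK i)

end Primitives

/-! ### Elementary groups and topological conjugacy -/

section Conjugation

theorem D_eq_one_of_eqOn {s t : Set ℝ} {g : DiffOne s} {x : s} (hts : t ⊆ s) (hxt : (x : ℝ) ∈ t)
    (ht : UniqueDiffWithinAt ℝ t x) (h : ∀ y : s, (y : ℝ) ∈ t → g.1 y = y) : g.D x = 1 := by
  have h1 : EqOn (extendById g.1) id t := fun y hy => by
    rw [extendById_coe g.1 ⟨y, hts hy⟩, h _ hy]; rfl
  exact ht.eq_deriv _ ((g.hasDerivWithinAt x).mono hts)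
    ((_root_.hasDerivWithinAt_id (x : ℝ) t).congr h1 (h1 hxt))

/-- The moved points form an interval, so an interior fixed point has only fixed points on one of
its sides, and a one-sided derivative determines the derivative there. -/
theorem IsSimple.withoutHyperbolicFixedPoint {g : DiffOne (Icc (0 : ℝ) 1)} (hg : g.IsSimple)
    (ht : g.IsTangentToIdAtEnds) : g.WithoutHyperbolicFixedPoint := by
  intro x hx
  rcases x.2.1.eq_or_lt with h0 | h0
  · rw [show x = ⟨0, by simp⟩ from Subtype.ext h0.symm]
    exact ht.1
  rcases x.2.2.eq_or_lt with h1 | h1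
  · rw [show x = ⟨1, by simp⟩ from Subtype.ext h1]
    exact ht.2
  by_cases hl : ∀ y ≤ x, g.1 y = y
  · exact D_eq_one_of_eqOn (t := Icc 0 x) (Icc_subset_Icc_right x.2.2) (right_mem_Icc.2 h0.le)
      (uniqueDiffOn_Icc h0 _ (right_mem_Icc.2 h0.le)) fun y hy => hl y hy.2
  · push Not at hl
    obtain ⟨y, hyx, hy⟩ := hl
    refine D_eq_one_of_eqOn (t := Icc x 1) (Icc_subset_Icc_left x.2.1) (left_mem_Icc.2 h1.le)
      (uniqueDiffOn_Icc h1 _ (left_mem_Icc.2 h1.le)) fun z hz => ?_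
    by_contra hzz
    exact hg.isPreconnected.ordConnected.out hy hzz ⟨hyx, hz.1⟩ hx

theorem IsElementary.isC1CloseToId {G : Subgroup (DiffOne (Icc (0 : ℝ) 1))}
    (hG : IsElementary G) : IsC1CloseToId G := by
  obtain ⟨S, I, hS, hn, rfl⟩ := hG
  have := (closure_range_Icc
    (fun f : S => (hS f f.2).1.withoutHyperbolicFixedPoint (hS f f.2).2) hn).1
  rwa [Subtype.range_coe] at this

section conjugation

variable {s : Set ℝ} {φ : s ≃ₜ s} {f k : DiffOne s}

theorem setOf_ne_of_semiconj (h : ∀ x, k.1 (φ x) = φ (f.1 x)) :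
    {x | k.1 x ≠ x} = φ '' {x | f.1 x ≠ x} := by
  ext y
  obtain ⟨x, rfl⟩ := φ.surjective y
  rw [φ.injective.mem_set_image, Set.mem_ofPred_eq, Set.mem_ofPred_eq, h, φ.injective.ne_iff]

theorem supp_of_semiconj (h : ∀ x, k.1 (φ x) = φ (f.1 x)) : k.supp = φ '' f.supp := by
  rw [supp, supp, setOf_ne_of_semiconj h, φ.image_closure]

theorem eq_of_semiconj {k' : DiffOne s} (h : ∀ x, k.1 (φ x) = φ (f.1 x))
    (h' : ∀ x, k'.1 (φ x) = φ (f.1 x)) : k = k' := by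
  refine Subtype.ext (Equiv.ext fun y => ?_)
  obtain ⟨x, rfl⟩ := φ.surjective y
  rw [h, h']

theorem IsSimple.of_semiconj (h : ∀ x, k.1 (φ x) = φ (f.1 x)) (hf : f.IsSimple) :
    k.IsSimple := by
  rw [IsSimple, setOf_ne_of_semiconj h]
  exact hf.image φ φ.continuous.continuousOn

theorem IsFundamentalDomain.of_semiconj (hφ : StrictMono φ ∨ StrictAnti φ)
    (h : ∀ x, k.1 (φ x) = φ (f.1 x)) {I : Set s} (hI : f.IsFundamentalDomain I) :
    k.IsFundamentalDomain (φ '' I) := by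
  rcases hφ with hφ | hφ
  · have himg : ∀ a b, φ '' Icc a b = Icc (φ a) (φ b) := by
      intro a b
      ext y
      obtain ⟨x, rfl⟩ := φ.surjective y
      rw [φ.injective.mem_set_image, mem_Icc, mem_Icc, hφ.le_iff_le, hφ.le_iff_le]
    obtain ⟨x, ⟨hx, rfl⟩ | ⟨hx, rfl⟩⟩ := hI
    · exact ⟨φ x, Or.inl ⟨by rw [h]; exact hφ hx, by rw [h, himg]⟩⟩
    · exact ⟨φ x, Or.inr ⟨by rw [h]; exact hφ hx, by rw [h, himg]⟩⟩
  · have himg : ∀ a b, φ '' Icc a b = Icc (φ b) (φ a) := by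
      intro a b
      ext y
      obtain ⟨x, rfl⟩ := φ.surjective y
      rw [φ.injective.mem_set_image, mem_Icc, mem_Icc, hφ.le_iff_ge, hφ.le_iff_ge, and_comm]
    obtain ⟨x, ⟨hx, rfl⟩ | ⟨hx, rfl⟩⟩ := hI
    · exact ⟨φ x, Or.inr ⟨by rw [h]; exact hφ hx, by rw [h, himg]⟩⟩
    · exact ⟨φ x, Or.inl ⟨by rw [h]; exact hφ hx, by rw [h, himg]⟩⟩

theorem exists_semiconj_mem_closure {S T : Set (DiffOne s)}
    (hST : ∀ f ∈ S, ∃ k ∈ T, ∀ x, k.1 (φ x) = φ (f.1 x)) {g : DiffOne s}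
    (hg : g ∈ Subgroup.closure S) :
    ∃ k ∈ Subgroup.closure T, ∀ x, k.1 (φ x) = φ (g.1 x) := by
  induction hg using Subgroup.closure_induction with
  | mem g hg =>
    obtain ⟨k, hk, h⟩ := hST g hg
    exact ⟨k, Subgroup.subset_closure hk, h⟩
  | one => exact ⟨1, one_mem _, fun x => rfl⟩
  | mul g₁ g₂ _ _ ih₁ ih₂ =>
    obtain ⟨k₁, hk₁, h₁⟩ := ih₁
    obtain ⟨k₂, hk₂, h₂⟩ := ih₂
    refine ⟨k₁ * k₂, mul_mem hk₁ hk₂, fun x => ?_⟩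
    change k₁.1 (k₂.1 (φ x)) = φ (g₁.1 (g₂.1 x))
    rw [h₂, h₁]
  | inv g _ ih =>
    obtain ⟨k, hk, h⟩ := ih
    refine ⟨k⁻¹, inv_mem hk, fun x => ?_⟩
    change k.1⁻¹ (φ x) = φ (g.1⁻¹ x)
    rw [Equiv.Perm.inv_eq_iff_eq, h]
    exact congrArg φ (g.1.apply_symm_apply x).symm

end conjugation

theorem strictMono_or_strictAnti (φ : Icc (0 : ℝ) 1 ≃ₜ Icc (0 : ℝ) 1) :
    StrictMono φ ∨ StrictAnti φ :=
  φ.continuous.strictMono_of_inj φ.injective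

theorem IsElementary.of_topConjugate {G H : Subgroup (DiffOne (Icc (0 : ℝ) 1))}
    (hG : IsElementary G) (hGH : TopConjugate G H) (hH : ∀ k ∈ H, k.IsTangentToIdAtEnds) :
    IsElementary H := by
  obtain ⟨S, I, hS, ⟨hI, hn⟩, rfl⟩ := hG
  obtain ⟨φ, hφ, hφ'⟩ := hGH
  -- The conjugates of the generators; differentiability comes from membership in `H`, as `φ` is
  -- only a homeomorphism.
  set T : Set (DiffOne (Icc (0 : ℝ) 1)) := {k ∈ H | ∃ f ∈ S, ∀ x, k.1 (φ x) = φ (f.1 x)} with hT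
  have hTS : ∀ k : T, ∃ f : S, ∀ x, k.1.1 (φ x) = φ (f.1.1 x) := fun k => by
    obtain ⟨f, hf, h⟩ := k.2.2
    exact ⟨⟨f, hf⟩, h⟩
  choose F hF using hTS
  refine ⟨T, fun k => φ '' I (F k), fun k hk => ⟨?_, hH k hk.1⟩, ⟨fun k => ?_, ?_⟩, ?_⟩
  · exact (hS _ (F ⟨k, hk⟩).2).1.of_semiconj (hF ⟨k, hk⟩)
  · exact (hI (F k)).of_semiconj (strictMono_or_strictAnti φ) (hF k)
  · intro k l hkl
    have hne : F k ≠ F l := by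
      intro h
      refine hkl (Subtype.ext (eq_of_semiconj (hF k) ?_))
      rw [h]
      exact hF l
    rw [supp_of_semiconj (hF k), supp_of_semiconj (hF l)]
    rcases hn _ _ hne with h | h | h
    · exact Or.inl (image_mono h)
    · exact Or.inr (Or.inl (image_mono h))
    · refine Or.inr (Or.inr ?_)
      rw [← φ.image_interior, ← φ.image_interior, ← image_inter φ.injective, h, image_empty]
  -- An element of `H` is the conjugate of a word in `S`, whose conjugate is also a word in `T`; the
  -- conjugate is unique.
  · refine le_antisymm (fun k hk => ?_) ((Subgroup.closure_le H).2 fun k hk => hk.1)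
    obtain ⟨g, hg, h⟩ := hφ' k hk
    obtain ⟨l, hl, h'⟩ := exists_semiconj_mem_closure (T := T) (φ := φ) (fun f hf => by
      obtain ⟨k, hk, h⟩ := hφ f (Subgroup.subset_closure hf)
      exact ⟨k, ⟨hk, f, hf, h⟩, h⟩) hg
    rwa [eq_of_semiconj h h']

end Conjugation

end DiffOne

theorem theorem4 :
    -- elementary groups are `C¹`-close to the identity
    (∀ G : Subgroup (DiffOne (Icc (0 : ℝ) 1)), DiffOne.IsElementary G →
      DiffOne.IsC1CloseToId G) ∧
    -- so are the groups that are topologically conjugate to them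
    (∀ G H : Subgroup (DiffOne (Icc (0 : ℝ) 1)), DiffOne.IsElementary G →
      DiffOne.TopConjugate G H → (∀ k ∈ H, k.IsTangentToIdAtEnds) →
      DiffOne.IsC1CloseToId H) ∧
    -- the stronger form on `[0,1]`, without simplicity
    (∀ (ι : Type*) (f : ι → DiffOne (Icc (0 : ℝ) 1)) (I : ι → Set (Icc (0 : ℝ) 1)),
      (∀ i, (f i).WithoutHyperbolicFixedPoint) →
      DiffOne.NestedFundamentalDomains f I →
      DiffOne.IsC1CloseToId (Subgroup.closure (range f)) ∧
      DiffOne.IsIsotopicByConjugacyToId (Subgroup.closure (range f))) ∧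
    -- the stronger form for compactly supported diffeomorphisms of `ℝ`
    (∀ (ι : Type*) (f : ι → DiffOne (univ : Set ℝ)) (I : ι → Set (univ : Set ℝ)),
      (∀ i, IsCompact (f i).supp) →
      (∀ i, (f i).WithoutHyperbolicFixedPoint) →
      DiffOne.NestedFundamentalDomains f I →
      DiffOne.IsC1CloseToId (Subgroup.closure (range f)) ∧
      DiffOne.IsIsotopicByConjugacyToId (Subgroup.closure (range f))) := by

  exact ⟨fun _ hG => hG.isC1CloseToId,
    fun _ _ hG hGH hH => (hG.of_topConjugate hGH hH).isC1CloseToId,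
    fun _ _ _ hf hn => DiffOne.closure_range_Icc hf hn,
    fun _ _ _ hK hf hn => DiffOne.closure_range_univ hK hf hn⟩
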